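/- **Notation.** A set $S\subseteq\mathbb R^k$ is *MICP-representable* (MICP-R) if there are positive integers $a,b$ and a closed convex set $\mathcal M\subseteq\mathbb R^{k+a+b}$ such that $x\in S$ if and only if $(x,y,z)\in\mathcal M$ for some $y\in\mathbb R^a$, $z\in\mathbb Z^b$. A real function is MICP-R if its domain and its epigraph are. The encoding length of an integer $k$ is $\langle k\rangle=1+\lceil\log_2(|k|+1)\rceil$, that of a non-integer rational $a/b$ in lowest terms ($b>0$) is $\langle a\rangle+\langle b\rangle$, and that of a list of numbers is the sum of the encoding lengths of its entries. **Theorem.** Let $N\ge \ell+1$, $D\in\mathbb Z^{\ell\times N}$, $d\in\mathbb Q^{\ell}$ and $\mathcal P=\{p\in\mathbb R^N_+ : Dp\le d,\ \sum_i p_i=1\}$. Let $\mathcal X\subseteq\mathbb R^n$, $Q:\mathbb R^n\times\mathbb R^m\to\mathbb R$ and $\xi^1,\dots,\xi^N\in\mathbb R^m$ be such that $\mathcal X$ and the functions $Q(\cdot,\xi^i)$ on $\mathcal X$ are MICP-R and $U_i=\sup_{x\in\mathcal X}|Q(x,\xi^i)|$ is a real number for every $i$. Let $\bar L$ be the largest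 total encoding length of $\ell+1$ rows of the $(N+1)\times(\ell+1)$ matrix $\begin{bmatrix} d^\top & 1\\ D^\top & e\end{bmatrix}$, where $e$ is the all-ones vector. Let $M_{j,1},M_{j,2}$ ($j\in[\ell]$) and $\bar M_i$ ($i\in[N]$) be real numbers with $$M_{j,1}\ge \Big(\max_{k}U_k\Big)(\ell+1)2^{\bar L},\qquad M_{j,2}\ge d_j+\sum_{i\in[N]}|D_{ji}|,$$ $$\bar M_i\ge \Big(\max_{k}U_k\Big)\Big(\sum_{j\in[\ell]}|D_{ji}|+1\Big)(\ell+1)2^{\bar L}+\Big(\min_{k}U_k\Big)(\ell+1)2^{\bar L}.$$ Consider the distributionally favorable problem $$\inf_{x\in\mathcal X}\ \inf_{p\in\mathcal P}\ \sum_{i\in[N]}p_i\,Q(x,\xi^i)\qquad(1)$$ and the program $$\inf_{x,v,t,\alpha,\beta,z,\bar z,p}\left\{t:\begin{array}{l} \beta-\alpha^\top d\le t,\quad \beta e- D^\top\alpha\le v,\\ 0\le\alpha_j\le M_{j,1}z_j,\quad 0\le d_j-\sum_i D_{ji}p_i\le M_{j,2}(1-z_j),\quad j\in[\ell],\\ 0\le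 p_i\le\bar z_i,\ i\in[N],\quad \sum_i p_i=1,\\ 0\le v_i+\sum_j D_{ji}\alpha_j-\beta\le\bar M_i(1-\bar z_i),\quad v_i\ge Q(x,\xi^i),\quad i\in[N],\\ z\in\{0,1\}^\ell,\ \bar z\in\{0,1\}^N,\ x\in\mathcal X \end{array}\right\}.\qquad(2)$$ Then (2) is a mixed-integer convex program (its feasible region, and its objective on that region, are MICP-R), and it is equivalent to (1): * (1) and (2) have the same optimal value in $[-\infty,+\infty]$, and a real number is the attained minimum of (1) if and only if it is the attained minimum of (2); * for all $x\in\mathbb R^n$ and $t\in\mathbb R$: there are $v,\alpha,\beta,z,\bar z,p$ such that $(x,v,t,\alpha,\beta,z,\bar z,p)$ is feasible in (2) if and only if $x\in\mathcal X$ and $\sum_i p_iQ(x,\xi^i)\le t$ for some $p\in\mathcal P$. -/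

import Mathlib

/-- A set `S` in a real (finite-dimensional) space is mixed-integer convex representable:
it is the projection of a closed convex set, some of whose coordinates are restricted
to the integers. -/
def IsMICPR {E : Type*} [AddCommGroup E] [Module ℝ E] [TopologicalSpace E] (S : Set E) : Prop :=
  ∃ (p d : ℕ) (M : Set (E × (Fin p → ℝ) × (Fin d → ℝ))),
    0 < p ∧ 0 < d ∧ IsClosed M ∧ Convex ℝ M ∧
      ∀ x : E, x ∈ S ↔
        ∃ (y : Fin p → ℝ) (z : Fin d → ℤ), (x, y, fun k => (z k : ℝ)) ∈ M

/-- The function `f`, with domain `S`, is mixed-integer convex representable: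
its domain and its epigraph are. -/
def IsMICPRFun {E : Type*} [AddCommGroup E] [Module ℝ E] [TopologicalSpace E]
    (S : Set E) (f : E → ℝ) : Prop :=
  IsMICPR S ∧ IsMICPR {q : E × ℝ | q.1 ∈ S ∧ f q.1 ≤ q.2}

/-- Encoding length of an integer, `1 + ⌈log₂ (|k| + 1)⌉`. -/
def intEncodingLength (k : ℤ) : ℕ := 1 + Nat.clog 2 (k.natAbs + 1)

/-- Encoding length of a rational number: an integer is encoded as an integer, any other
rational by its reduced numerator and denominator. -/
def ratEncodingLength (r : ℚ) : ℕ :=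
  if r.den = 1 then intEncodingLength r.num
  else intEncodingLength r.num + intEncodingLength (r.den : ℤ)

/-- The matrix with first row `(dᵀ, 1)` and, below it, the rows of `(Dᵀ, e)`. -/
def dualMatrix {ℓ N : ℕ} (D : Matrix (Fin ℓ) (Fin N) ℤ) (d : Fin ℓ → ℚ) :
    Matrix (Unit ⊕ Fin N) (Fin ℓ ⊕ Unit) ℚ :=
  Matrix.fromBlocks (Matrix.of fun _ j => d j) (Matrix.of fun _ _ => 1)
    (Matrix.of fun i j => (D j i : ℚ)) (Matrix.of fun _ _ => 1)

/-- Encoding length of row `r` of a rational matrix. -/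
def rowEncodingLength {R C : Type*} [Fintype C] (A : Matrix R C ℚ) (r : R) : ℕ :=
  ∑ c, ratEncodingLength (A r c)

/-- The largest encoding length of a choice of `k` rows of a rational matrix. -/
def maxRowsEncodingLength {R C : Type*} [Fintype R] [Fintype C] (A : Matrix R C ℚ) (k : ℕ) : ℕ :=
  (Finset.powersetCard k (Finset.univ : Finset R)).sup fun S => ∑ r ∈ S, rowEncodingLength A r

/-- The polyhedral ambiguity set `{p ≥ 0 : D p ≤ d, eᵀ p = 1}`. -/
def ambiguitySet {ℓ N : ℕ} (D : Matrix (Fin ℓ) (Fin N) ℤ) (d : Fin ℓ → ℚ) : Set (Fin N → ℝ) :=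
  {p | (∀ i, 0 ≤ p i) ∧ (∀ j, ∑ i, (D j i : ℝ) * p i ≤ (d j : ℝ)) ∧ ∑ i, p i = 1}

/-- The objective values of the finite-support distributionally favorable problem. -/
def dfoValues {n m ℓ N : ℕ} (X : Set (Fin n → ℝ)) (Q : (Fin n → ℝ) → (Fin m → ℝ) → ℝ)
    (ξ : Fin N → Fin m → ℝ) (D : Matrix (Fin ℓ) (Fin N) ℤ) (d : Fin ℓ → ℚ) : Set ℝ :=
  {r | ∃ x ∈ X, ∃ p ∈ ambiguitySet D d, r = ∑ i, p i * Q x (ξ i)}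

/-- The constraints of the big-M program, in the variables `x, v, t, α, β, z, zb, p`. -/
structure BigMFeasible {n m ℓ N : ℕ} (X : Set (Fin n → ℝ))
    (Q : (Fin n → ℝ) → (Fin m → ℝ) → ℝ) (ξ : Fin N → Fin m → ℝ)
    (D : Matrix (Fin ℓ) (Fin N) ℤ) (d : Fin ℓ → ℚ)
    (M₁ M₂ : Fin ℓ → ℝ) (Mb : Fin N → ℝ)
    (x : Fin n → ℝ) (v : Fin N → ℝ) (t : ℝ) (α : Fin ℓ → ℝ) (β : ℝ)
    (z : Fin ℓ → ℝ) (zb p : Fin N → ℝ) : Prop where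
  objective_le : β - ∑ j, α j * (d j : ℝ) ≤ t
  alpha_nonneg : ∀ j, 0 ≤ α j
  alpha_le : ∀ j, α j ≤ M₁ j * z j
  primal_slack_nonneg : ∀ j, 0 ≤ (d j : ℝ) - ∑ i, (D j i : ℝ) * p i
  primal_slack_le : ∀ j, (d j : ℝ) - ∑ i, (D j i : ℝ) * p i ≤ M₂ j * (1 - z j)
  p_nonneg : ∀ i, 0 ≤ p i
  p_le : ∀ i, p i ≤ zb i
  p_sum : ∑ i, p i = 1
  dual_slack_nonneg : ∀ i, 0 ≤ v i + ∑ j, (D j i : ℝ) * α j - β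
  dual_slack_le : ∀ i, v i + ∑ j, (D j i : ℝ) * α j - β ≤ Mb i * (1 - zb i)
  cost_le : ∀ i, Q x (ξ i) ≤ v i
  z_binary : ∀ j, z j = 0 ∨ z j = 1
  zb_binary : ∀ i, zb i = 0 ∨ zb i = 1
  x_mem : x ∈ X

/-- The space of the variables `(x, v, t, α, β, z, zb, p)`. -/
abbrev BigMVars (n ℓ N : ℕ) : Type :=
  (Fin n → ℝ) × (Fin N → ℝ) × ℝ × (Fin ℓ → ℝ) × ℝ × (Fin ℓ → ℝ) × (Fin N → ℝ) × (Fin N → ℝ)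

/-- The objective of the big-M program, the variable `t`. -/
def bigMObjective {n ℓ N : ℕ} (w : BigMVars n ℓ N) : ℝ := w.2.2.1

/-- The feasible region of the big-M program. -/
def bigMRegion {n m ℓ N : ℕ} (X : Set (Fin n → ℝ))
    (Q : (Fin n → ℝ) → (Fin m → ℝ) → ℝ) (ξ : Fin N → Fin m → ℝ)
    (D : Matrix (Fin ℓ) (Fin N) ℤ) (d : Fin ℓ → ℚ)
    (M₁ M₂ : Fin ℓ → ℝ) (Mb : Fin N → ℝ) : Set (BigMVars n ℓ N) :=
  {(x, v, t, α, β, z, zb, p) | BigMFeasible X Q ξ D d M₁ M₂ Mb x v t α β z zb p}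

/-! For fixed `x` the inner problem is a linear program over a polytope, so an optimal `p` has a
dual solution `(α, β)` with slack `s` satisfying complementary slackness. The constraints of (2) are
primal feasibility, dual feasibility and complementary slackness, the latter encoded by binaries.
Hence any feasible point of (2) certifies `∑ pᵢ Q(x, ξⁱ) ≤ t`, whatever the big-M constants are
(`BigMFeasible.mem_ambiguitySet_and_le`).

The converse needs a dual solution that fits under the big-M constants. Starting from any
complementary dual solution, Carathéodory reduction makes the active columns linearly independent
without enlarging supports, so complementarity survives. The entries then solve a square integral
system. By Cramer's rule, with a denominator of absolute value at least 1, they are at most `max U`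
times a product of row sums (`exists_basic_solution`). Encoding lengths bound that product by `2 ^ L
/ 2`.

Representability of (2) follows from closure of MICP-representable sets under finite intersections
and continuous linear preimages. -/

/-! ### Finitely generated cones and Farkas' lemma. -/

/-- **Carathéodory's theorem** for cones: a nonnegative combination can be rewritten with
linearly independent generators, without enlarging the support. -/
theorem exists_nonneg_combination_linearIndepOn {ι E : Type*} [Fintype ι] [AddCommGroup E]
    [Module ℝ E] (v : ι → E) (w : ι → ℝ) (hw : ∀ i, 0 ≤ w i) :
    ∃ w' : ι → ℝ, (∀ i, 0 ≤ w' i) ∧ ∑ i, w' i • v i = ∑ i, w i • v i ∧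
      (∀ i, w i = 0 → w' i = 0) ∧ LinearIndepOn ℝ v {i | w' i ≠ 0} := by
  classical
  induction hn : (Finset.univ.filter fun i => w i ≠ 0).card using Nat.strong_induction_on
    generalizing w with
  | _ n ih =>
  set s := Finset.univ.filter fun i => w i ≠ 0 with hs
  by_cases hli : LinearIndepOn ℝ v {i | w i ≠ 0}
  · exact ⟨w, hw, rfl, fun _ h => h, hli⟩
  have hcoe : {i | w i ≠ 0} = (s : Set ι) := by ext; simp [hs]
  rw [hcoe, linearIndepOn_finset_iff] at hli
  push Not at hli
  obtain ⟨g₀, hg₀, k, hk, hgk₀⟩ := hli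
  obtain ⟨g, hg, hgk⟩ : ∃ g : ι → ℝ, ∑ i ∈ s, g i • v i = 0 ∧ 0 < g k := by
    rcases lt_or_gt_of_ne hgk₀ with h | h
    · exact ⟨fun i => -g₀ i, by simp [hg₀], by simpa using h⟩
    · exact ⟨g₀, hg₀, h⟩
  -- Ratio test: the minimal ratio is the largest multiple of `g` that can be subtracted from `w`
  -- without losing nonnegativity, and it annihilates the coefficient at `i₀`.
  obtain ⟨i₀, hi₀, hmin⟩ := (s.filter fun i => 0 < g i).exists_min_image (fun i => w i / g i)
    ⟨k, by simp [hk, hgk]⟩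
  obtain ⟨hi₀s, hgi₀⟩ := Finset.mem_filter.1 hi₀
  set c := w i₀ / g i₀ with hc
  have hc0 : 0 ≤ c := div_nonneg (hw _) hgi₀.le
  let u : ι → ℝ := fun i => if i ∈ s then w i - c * g i else 0
  have hu0 : ∀ i, 0 ≤ u i := by
    intro i
    by_cases hi : i ∈ s
    · simp only [u, hi, if_true]
      by_cases hgi : 0 < g i
      · have := hmin i (by simp [hi, hgi])
        rw [le_div_iff₀ hgi] at this
        linarith
      · have := mul_nonpos_of_nonneg_of_nonpos hc0 (not_lt.1 hgi)
        linarith [hw i]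
    · simp [u, hi]
  have husupp : ∀ i, w i = 0 → u i = 0 := by
    intro i hi
    simp [u, hs, hi]
  have hui₀ : u i₀ = 0 := by
    simp only [u, hi₀s, if_true, hc]
    field_simp
    ring
  have hsum : ∑ i, u i • v i = ∑ i, w i • v i := by
    have h1 : ∑ i, u i • v i = ∑ i ∈ s, (w i - c * g i) • v i := by
      simp [u, ite_smul, Finset.sum_ite_mem]
    have h2 : ∑ i, w i • v i = ∑ i ∈ s, w i • v i := by
      rw [hs, Finset.sum_filter]
      refine Finset.sum_congr rfl fun i _ => ?_
      by_cases h : w i = 0 <;> simp [h]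
    rw [h1, h2]
    simp only [sub_smul, Finset.sum_sub_distrib, mul_smul, ← Finset.smul_sum, hg, smul_zero,
      sub_zero]
  have hcard : (Finset.univ.filter fun i => u i ≠ 0).card < n := by
    rw [← hn]
    refine Finset.card_lt_card ⟨fun i hi => ?_, fun h => ?_⟩
    · simp only [Finset.mem_filter, Finset.mem_univ, true_and, hs] at hi ⊢
      exact fun h => hi (husupp i h)
    · have := h hi₀s
      simp [hui₀] at this
  obtain ⟨w', h0, h1, h2, h3⟩ := ih _ hcard u hu0 rfl
  exact ⟨w', h0, h1.trans hsum, fun i hi => h2 i (husupp i hi), h3⟩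

/-- A finitely generated cone in a finite-dimensional space is closed. -/
theorem isClosed_setOf_nonneg_combination {ι E : Type*} [Fintype ι] [NormedAddCommGroup E]
    [NormedSpace ℝ E] [FiniteDimensional ℝ E] (v : ι → E) :
    IsClosed {x : E | ∃ w : ι → ℝ, (∀ i, 0 ≤ w i) ∧ ∑ i, w i • v i = x} := by
  classical
  -- By Carathéodory the cone is a finite union of simplicial cones, each the image of a closed
  -- orthant under an injective linear map, hence closed.
  have key : {x : E | ∃ w : ι → ℝ, (∀ i, 0 ≤ w i) ∧ ∑ i, w i • v i = x} =
      ⋃ s ∈ {s : Finset ι | LinearIndepOn ℝ v (s : Set ι)},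
        (Fintype.linearCombination ℝ (fun i : s => v i)) '' {w | ∀ i, 0 ≤ w i} := by
    ext x
    simp only [Set.mem_ofPred_eq, Set.mem_iUnion, exists_prop, Set.mem_image]
    constructor
    · rintro ⟨w, hw, rfl⟩
      obtain ⟨w', h0, h1, -, h3⟩ := exists_nonneg_combination_linearIndepOn v w hw
      refine ⟨Finset.univ.filter fun i => w' i ≠ 0, by simpa using h3, fun i => w' i,
        fun i => h0 i, ?_⟩
      rw [Fintype.linearCombination_apply, ← h1,
        Finset.sum_coe_sort (Finset.univ.filter fun i => w' i ≠ 0) (fun i => w' i • v i),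
        Finset.sum_filter]
      refine Finset.sum_congr rfl fun i _ => ?_
      by_cases h : w' i = 0 <;> simp [h]
    · rintro ⟨s, -, w, hw, rfl⟩
      refine ⟨fun i => if h : i ∈ s then w ⟨i, h⟩ else 0, fun i => ?_, ?_⟩
      · dsimp only
        split_ifs
        · exact hw _
        · exact le_rfl
      · rw [Fintype.linearCombination_apply, ← Finset.sum_subset (Finset.subset_univ s),
          ← Finset.sum_coe_sort s]
        · exact Finset.sum_congr rfl fun i _ => by simp
        · intro i _ hi
          simp [hi]
  rw [key]
  refine Set.Finite.isClosed_biUnion (Set.toFinite _) fun s hs => ?_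
  refine (LinearMap.isClosedEmbedding_of_injective ?_).isClosedMap _ ?_
  · rw [LinearMap.ker_eq_bot]
    exact LinearIndependent.fintypeLinearCombination_injective hs
  · simp only [Set.ofPred_forall]
    exact isClosed_iInter fun i => isClosed_le continuous_const (continuous_apply i)

/-- **Farkas' lemma**. -/
theorem exists_nonneg_combination_of_forall_dual {ι E : Type*} [Fintype ι]
    [NormedAddCommGroup E] [NormedSpace ℝ E] [FiniteDimensional ℝ E] (v : ι → E) (b : E)
    (h : ∀ f : E →L[ℝ] ℝ, (∀ i, 0 ≤ f (v i)) → 0 ≤ f b) :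
    ∃ w : ι → ℝ, (∀ i, 0 ≤ w i) ∧ ∑ i, w i • v i = b := by
  classical
  by_contra hb
  have hconv : Convex ℝ {x : E | ∃ w : ι → ℝ, (∀ i, 0 ≤ w i) ∧ ∑ i, w i • v i = x} := by
    rintro x ⟨w, hw, rfl⟩ y ⟨w', hw', rfl⟩ a c ha hc -
    refine ⟨fun i => a * w i + c * w' i, fun i =>
      add_nonneg (mul_nonneg ha (hw i)) (mul_nonneg hc (hw' i)), ?_⟩
    simp only [add_smul, mul_smul, Finset.sum_add_distrib, Finset.smul_sum]
  obtain ⟨f, u, hfb, hfu⟩ := geometric_hahn_banach_point_closed hconv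
    (isClosed_setOf_nonneg_combination v) hb
  have hu : u < 0 := by
    simpa using hfu 0 ⟨0, by simp, by simp⟩
  have hpos : ∀ i, 0 ≤ f (v i) := by
    intro i
    by_contra hi
    push Not at hi
    -- This positive multiple of the generator lies in the cone, yet `f` takes exactly the value `u`
    -- there.
    have := hfu ((u / f (v i)) • v i) ⟨Pi.single i (u / f (v i)), fun k => ?_, ?_⟩
    · rw [map_smul, smul_eq_mul, div_mul_cancel₀ _ hi.ne] at this
      exact lt_irrefl _ this
    · by_cases hk : k = i
      · subst hk
        simpa using div_nonneg_of_nonpos hu.le hi.le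
      · simp [hk]
    · simp [Pi.single_apply, ite_smul]
  linarith [h f hpos]

/-! ### Determinants and Cramer's rule. -/

/-- Expanding the product of row sums gives one term for every map `κ → κ`; the Leibniz formula uses
only those coming from permutations. -/
theorem abs_det_le_prod_sum_abs {κ : Type*} [Fintype κ] [DecidableEq κ] (A : Matrix κ κ ℝ) :
    |A.det| ≤ ∏ i, ∑ j, |A i j| := by
  rw [← Matrix.det_transpose, Matrix.det_apply, Finset.prod_univ_sum, Fintype.piFinset_univ]
  calc |∑ σ : Equiv.Perm κ, Equiv.Perm.sign σ • ∏ i, A.transpose (σ i) i|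
      ≤ ∑ σ : Equiv.Perm κ, |Equiv.Perm.sign σ • ∏ i, A.transpose (σ i) i| :=
        Finset.abs_sum_le_sum_abs _ _
    _ = ∑ σ : Equiv.Perm κ, ∏ i, |A i (σ i)| := by
        refine Finset.sum_congr rfl fun σ _ => ?_
        rw [← Finset.abs_prod]
        rcases Int.units_eq_one_or (Equiv.Perm.sign σ) with h | h <;> simp [h]
    _ = ∑ f ∈ Finset.univ.image (fun σ : Equiv.Perm κ => (σ : κ → κ)), ∏ i, |A i (f i)| := by
        rw [Finset.sum_image fun σ _ τ _ h => DFunLike.coe_injective h]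
    _ ≤ ∑ f : κ → κ, ∏ i, |A i (f i)| :=
        Finset.sum_le_sum_of_subset_of_nonneg (Finset.subset_univ _)
          fun _ _ _ => Finset.prod_nonneg fun _ _ => abs_nonneg _

/-- A matrix with linearly independent columns has an invertible square submatrix
formed by all the columns. -/
theorem exists_submatrix_det_ne_zero {R κ : Type*} [Fintype κ] [DecidableEq κ] [Finite R]
    (A : Matrix R κ ℝ) (h : LinearIndependent ℝ A.col) :
    ∃ f : κ → R, Function.Injective f ∧ (A.submatrix f id).det ≠ 0 := by
  classical
  have := Fintype.ofFinite R
  -- Row rank equals column rank, so the rows span and a maximal independent set of them is a basis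
  -- indexed by `κ`.
  have hspan : Submodule.span ℝ (Set.range A.row) = ⊤ := by
    apply Submodule.eq_top_of_finrank_eq
    rw [← A.rank_eq_finrank_span_row, ← A.rank_transpose,
      (show LinearIndependent ℝ A.transpose.row from h).rank_matrix,
      Module.finrank_fintype_fun_eq_card]
  obtain ⟨s, hs, hsp⟩ : ∃ s : Set R, LinearIndepOn ℝ A.row s ∧
      Submodule.span ℝ (A.row '' s) = ⊤ := by
    obtain ⟨s, -, -, h1, h2⟩ := exists_linearIndepOn_extension (v := A.row)
      (linearIndepOn_empty ℝ A.row) (Set.subset_univ _)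
    refine ⟨s, h2, ?_⟩
    rw [eq_top_iff, ← hspan, Submodule.span_le, ← Set.image_univ]
    exact h1
  let b : Module.Basis s ℝ (κ → ℝ) := Module.Basis.mk hs (by
    rw [← hsp, Set.image_eq_range])
  let e : κ ≃ s := (Pi.basisFun ℝ κ).indexEquiv b
  refine ⟨fun k => e k, Subtype.val_injective.comp e.injective, ?_⟩
  have hli : LinearIndependent ℝ (A.submatrix (fun k => (e k : R)) id).row :=
    hs.comp e e.injective
  exact ((Matrix.isUnit_iff_isUnit_det _).1 (Matrix.linearIndependent_rows_iff_isUnit.1 hli)).ne_zero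

/-- Cramer's rule bound: a solution of a system with linearly independent integral columns
and right-hand side bounded by `u` is bounded by `u` times a product of row sums. -/
theorem exists_abs_le_of_linearIndependent_col {R κ : Type*} [Fintype κ] [Finite R]
    (A : Matrix R κ ℤ) (h : LinearIndependent ℝ (A.map (Int.cast : ℤ → ℝ)).col)
    (x : κ → ℝ) {u : ℝ} (hx : ∀ r, |∑ k, (A r k : ℝ) * x k| ≤ u) :
    ∃ f : κ → R, Function.Injective f ∧ ∀ k, |x k| ≤ u * ∏ i, (1 + ∑ j, |(A (f i) j : ℝ)|) := by
  classical
  obtain ⟨f, hf, hdet⟩ := exists_submatrix_det_ne_zero _ h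
  refine ⟨f, hf, fun k => ?_⟩
  have hu : 0 ≤ u := (abs_nonneg _).trans (hx (f k))
  set B := A.submatrix f id with hB
  have hBmap : (A.map (Int.cast : ℤ → ℝ)).submatrix f id = B.map (Int.cast : ℤ → ℝ) := rfl
  rw [hBmap] at hdet
  set C := B.map (Int.cast : ℤ → ℝ) with hC
  -- A nonzero integer has absolute value at least 1; this is where integrality of `A` enters.
  have hdetC : 1 ≤ |C.det| := by
    have h1 : C.det = ((B.det : ℤ) : ℝ) := by
      rw [hC]
      exact ((Int.castRingHom ℝ).map_det B).symm
    rw [h1] at hdet ⊢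
    exact_mod_cast Int.one_le_abs (by exact_mod_cast hdet)
  have hcr : C.det * x k = (C.updateCol k (C.mulVec x)).det := by
    have h1 : C.cramer (C.mulVec x) = C.det • x := by
      rw [Matrix.cramer_eq_adjugate_mulVec, Matrix.mulVec_mulVec, Matrix.adjugate_mul,
        Matrix.smul_mulVec, Matrix.one_mulVec]
    rw [← Matrix.cramer_apply, h1]
    rfl
  have hbound : |(C.updateCol k (C.mulVec x)).det| ≤ u * ∏ i, (1 + ∑ j, |C i j|) := by
    rcases hu.eq_or_lt with rfl | hu'
    · have h0 : C.mulVec x = 0 := by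
        ext i
        exact abs_eq_zero.1 (le_antisymm (hx (f i)) (abs_nonneg _))
      rw [h0, zero_mul, Matrix.det_eq_zero_of_column_eq_zero k (by simp), abs_zero]
    -- With `u` pulled out, the replaced column has entries at most 1 in absolute value, so it adds
    -- at most 1 to each row sum.
    · have h1 : C.mulVec x = u • (u⁻¹ • C.mulVec x) := by
        rw [smul_smul, mul_inv_cancel₀ hu'.ne', one_smul]
      rw [h1, Matrix.det_updateCol_smul, abs_mul, abs_of_pos hu']
      refine mul_le_mul_of_nonneg_left ((abs_det_le_prod_sum_abs _).trans ?_) hu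
      refine Finset.prod_le_prod (fun i _ => Finset.sum_nonneg fun _ _ => abs_nonneg _)
        fun i _ => ?_
      have h2 : ∀ j, |C.updateCol k (u⁻¹ • C.mulVec x) i j| ≤
          (if j = k then 1 else 0) + |C i j| := by
        intro j
        by_cases hj : j = k
        · subst hj
          have : |u⁻¹ * C.mulVec x i| ≤ 1 := by
            rw [abs_mul, abs_inv, abs_of_pos hu', inv_mul_le_iff₀ hu', mul_one]
            exact hx (f i)
          simpa using this.trans (le_add_of_nonneg_right (abs_nonneg (C i j)))
        · simp [hj]
      refine (Finset.sum_le_sum fun j _ => h2 j).trans ?_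
      simp [Finset.sum_add_distrib]
  rw [← hcr, abs_mul] at hbound
  exact (le_mul_of_one_le_left (abs_nonneg _) hdetC).trans hbound

/-! ### Closure properties of MICP-representable sets. -/

namespace IsMICPR

variable {E F : Type*} [AddCommGroup E] [Module ℝ E] [TopologicalSpace E]
  [AddCommGroup F] [Module ℝ F] [TopologicalSpace F]

theorem of_isClosed_convex {S : Set E} (hc : IsClosed S) (hconv : Convex ℝ S) : IsMICPR S := by
  -- The auxiliary coordinates are dummies, present because the definition requires at least one of
  -- each kind.
  refine ⟨1, 1, {w | w.1 ∈ S}, one_pos, one_pos, hc.preimage continuous_fst,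
    fun a ha b hb s t hs ht hst => hconv ha hb hs ht hst, fun x => ?_⟩
  exact ⟨fun hx => ⟨0, 0, hx⟩, fun ⟨_, _, hx⟩ => hx⟩

theorem preimage {S : Set F} (hS : IsMICPR S) (f : E →L[ℝ] F) : IsMICPR (f ⁻¹' S) := by
  obtain ⟨p, d, M, hp, hd, hM, hconv, h⟩ := hS
  refine ⟨p, d, {w | (f w.1, w.2) ∈ M}, hp, hd, hM.preimage (by fun_prop),
    fun a ha b hb s t hs ht hst => ?_, fun x => h (f x)⟩
  have := hconv ha hb hs ht hst
  simpa using this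

/-- Each set keeps its own block of auxiliary variables; only `x` is shared. -/
theorem inter {S T : Set E} (hS : IsMICPR S) (hT : IsMICPR T) : IsMICPR (S ∩ T) := by
  obtain ⟨p₁, d₁, M₁, hp₁, hd₁, hM₁, hconv₁, h₁⟩ := hS
  obtain ⟨p₂, d₂, M₂, hp₂, hd₂, hM₂, hconv₂, h₂⟩ := hT
  refine ⟨p₁ + p₂, d₁ + d₂,
    {w | (w.1, (fun k => w.2.1 (Fin.castAdd p₂ k)), fun k => w.2.2 (Fin.castAdd d₂ k)) ∈ M₁} ∩
    {w | (w.1, (fun k => w.2.1 (Fin.natAdd p₁ k)), fun k => w.2.2 (Fin.natAdd d₁ k)) ∈ M₂},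
    by omega, by omega,
    (hM₁.preimage (by fun_prop)).inter (hM₂.preimage (by fun_prop)),
    Convex.inter (fun a ha b hb s t hs ht hst => hconv₁ ha hb hs ht hst)
      (fun a ha b hb s t hs ht hst => hconv₂ ha hb hs ht hst), fun x => ?_⟩
  rw [Set.mem_inter_iff, h₁, h₂]
  constructor
  · rintro ⟨⟨y, z, h⟩, y', z', h'⟩
    exact ⟨Fin.append y y', Fin.append z z', by simpa using h, by simpa using h'⟩
  · rintro ⟨y, z, h, h'⟩
    exact ⟨⟨_, fun k => z (Fin.castAdd d₂ k), h⟩, _, fun k => z (Fin.natAdd d₁ k), h'⟩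

theorem setOf_forall {ι : Type*} [Finite ι] {P : ι → E → Prop}
    (h : ∀ i, IsMICPR {x | P i x}) : IsMICPR {x | ∀ i, P i x} := by
  classical
  have := Fintype.ofFinite ι
  suffices ∀ s : Finset ι, IsMICPR {x | ∀ i ∈ s, P i x} by simpa using this Finset.univ
  intro s
  induction s using Finset.induction_on with
  | empty => simpa using of_isClosed_convex (E := E) isClosed_univ convex_univ
  | insert i s _ ih =>
    have : {x | ∀ k ∈ insert i s, P k x} = {x | P i x} ∩ {x | ∀ k ∈ s, P k x} := by
      ext x
      simp
    rw [this]
    exact (h i).inter ih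

end IsMICPR

/-- Continuous real functions that preserve affine combinations. -/
structure IsContAffine {E : Type*} [AddCommGroup E] [Module ℝ E] [TopologicalSpace E]
    (f : E → ℝ) : Prop where
  continuous : Continuous f
  map_combo : ∀ x y (a b : ℝ), a + b = 1 → f (a • x + b • y) = a * f x + b * f y

namespace IsContAffine

variable {E : Type*} [AddCommGroup E] [Module ℝ E] [TopologicalSpace E] {f g : E → ℝ}

theorem const (c : ℝ) : IsContAffine fun _ : E => c :=
  ⟨continuous_const, fun _ _ a b h => by rw [← add_mul, h, one_mul]⟩

theorem add (hf : IsContAffine f) (hg : IsContAffine g) : IsContAffine fun x => f x + g x :=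
  ⟨hf.1.add hg.1, fun x y a b h => by rw [hf.2 x y a b h, hg.2 x y a b h]; ring⟩

theorem sub (hf : IsContAffine f) (hg : IsContAffine g) : IsContAffine fun x => f x - g x :=
  ⟨hf.1.sub hg.1, fun x y a b h => by rw [hf.2 x y a b h, hg.2 x y a b h]; ring⟩

theorem const_mul (hf : IsContAffine f) (c : ℝ) : IsContAffine fun x => c * f x :=
  ⟨hf.1.const_mul c, fun x y a b h => by rw [hf.2 x y a b h]; ring⟩

theorem mul_const (hf : IsContAffine f) (c : ℝ) : IsContAffine fun x => f x * c :=
  ⟨hf.1.mul_const c, fun x y a b h => by rw [hf.2 x y a b h]; ring⟩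

theorem sum {ι : Type*} [Fintype ι] {f : ι → E → ℝ} (hf : ∀ i, IsContAffine (f i)) :
    IsContAffine fun x => ∑ i, f i x :=
  ⟨continuous_finsetSum _ fun i _ => (hf i).1, fun x y a b h => by
    simp only [fun i => (hf i).2 x y a b h, Finset.sum_add_distrib, Finset.mul_sum]⟩

theorem isMICPR_le (hf : IsContAffine f) (hg : IsContAffine g) : IsMICPR {x | f x ≤ g x} :=
  .of_isClosed_convex (isClosed_le hf.1 hg.1) fun x hx y hy a b ha hb h => by
    simp only [Set.mem_ofPred_eq] at hx hy ⊢
    rw [hf.2 x y a b h, hg.2 x y a b h]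
    gcongr

theorem isMICPR_eq (hf : IsContAffine f) (hg : IsContAffine g) : IsMICPR {x | f x = g x} := by
  have : {x | f x = g x} = {x | f x ≤ g x} ∩ {x | g x ≤ f x} := by
    ext x
    exact le_antisymm_iff
  rw [this]
  exact (hf.isMICPR_le hg).inter (hg.isMICPR_le hf)

/-- An integer coordinate is confined to `[0, 1]` and equated with `f`. -/
theorem isMICPR_binary (hf : IsContAffine f) : IsMICPR {x | f x = 0 ∨ f x = 1} := by
  refine ⟨1, 1, {w | f w.1 = w.2.2 0 ∧ 0 ≤ w.2.2 0 ∧ w.2.2 0 ≤ 1}, one_pos, one_pos, ?_, ?_,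
    fun x => ?_⟩
  · have hz : Continuous fun w : E × (Fin 1 → ℝ) × (Fin 1 → ℝ) => w.2.2 0 := by fun_prop
    exact (isClosed_eq (hf.1.comp continuous_fst) hz).inter
      ((isClosed_le continuous_const hz).inter (isClosed_le hz continuous_const))
  · rintro ⟨x, y, z⟩ ⟨h1, h2, h3⟩ ⟨x', y', z'⟩ ⟨h1', h2', h3'⟩ a b ha hb h
    refine ⟨(hf.2 x x' a b h).trans ?_, ?_, ?_⟩
    · simp only at h1 h1'
      simp [h1, h1']
    · simp only [Prod.smul_mk, Prod.mk_add_mk, Pi.add_apply, Pi.smul_apply, smul_eq_mul] at *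
      positivity
    · simp only [Prod.smul_mk, Prod.mk_add_mk, Pi.add_apply, Pi.smul_apply, smul_eq_mul] at *
      nlinarith
  · constructor
    · rintro (h | h)
      · exact ⟨0, 0, by simp [h]⟩
      · exact ⟨0, 1, by simp [h]⟩
    · rintro ⟨y, z, h⟩
      obtain ⟨h1, h2, h3⟩ : f x = z 0 ∧ (0 : ℝ) ≤ z 0 ∧ (z 0 : ℝ) ≤ 1 := h
      rw [Set.mem_ofPred_eq]
      have h2' : 0 ≤ z 0 := by exact_mod_cast h2
      have h3' : z 0 ≤ 1 := by exact_mod_cast h3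
      rw [h1]
      obtain h | h : z 0 = 0 ∨ z 0 = 1 := by omega
      · exact .inl (by simp [h])
      · exact .inr (by simp [h])

end IsContAffine

theorem isMICPR_bigMRegion {n m ℓ N : ℕ} {X : Set (Fin n → ℝ)}
    {Q : (Fin n → ℝ) → (Fin m → ℝ) → ℝ} {ξ : Fin N → Fin m → ℝ}
    (D : Matrix (Fin ℓ) (Fin N) ℤ) (d : Fin ℓ → ℚ)
    (hX : IsMICPR X) (hQ : ∀ i, IsMICPRFun X (fun x => Q x (ξ i)))
    (M₁ M₂ : Fin ℓ → ℝ) (Mb : Fin N → ℝ) :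
    IsMICPR (bigMRegion X Q ξ D d M₁ M₂ Mb) := by
  have hv : ∀ i, IsContAffine fun w : BigMVars n ℓ N => w.2.1 i := fun i =>
    ⟨by fun_prop, fun _ _ _ _ _ => rfl⟩
  have ht : IsContAffine fun w : BigMVars n ℓ N => w.2.2.1 :=
    ⟨by fun_prop, fun _ _ _ _ _ => rfl⟩
  have hα : ∀ j, IsContAffine fun w : BigMVars n ℓ N => w.2.2.2.1 j := fun j =>
    ⟨by fun_prop, fun _ _ _ _ _ => rfl⟩
  have hβ : IsContAffine fun w : BigMVars n ℓ N => w.2.2.2.2.1 :=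
    ⟨by fun_prop, fun _ _ _ _ _ => rfl⟩
  have hz : ∀ j, IsContAffine fun w : BigMVars n ℓ N => w.2.2.2.2.2.1 j := fun j =>
    ⟨by fun_prop, fun _ _ _ _ _ => rfl⟩
  have hzb : ∀ i, IsContAffine fun w : BigMVars n ℓ N => w.2.2.2.2.2.2.1 i := fun i =>
    ⟨by fun_prop, fun _ _ _ _ _ => rfl⟩
  have hp : ∀ i, IsContAffine fun w : BigMVars n ℓ N => w.2.2.2.2.2.2.2 i := fun i =>
    ⟨by fun_prop, fun _ _ _ _ _ => rfl⟩
  have h0 := IsContAffine.const (E := BigMVars n ℓ N) 0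
  have h1 := IsContAffine.const (E := BigMVars n ℓ N) 1
  have hps : ∀ j, IsContAffine fun w : BigMVars n ℓ N =>
      (d j : ℝ) - ∑ i, (D j i : ℝ) * w.2.2.2.2.2.2.2 i := fun j =>
    (IsContAffine.const _).sub (.sum fun i => (hp i).const_mul _)
  have hds : ∀ i, IsContAffine fun w : BigMVars n ℓ N =>
      w.2.1 i + ∑ j, (D j i : ℝ) * w.2.2.2.1 j - w.2.2.2.2.1 := fun i =>
    ((hv i).add (.sum fun j => (hα j).const_mul _)).sub hβ
  -- The epigraph is representable only over `X`, so membership in `X` accompanies each cost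
  -- constraint.
  have hcost : ∀ i, IsMICPR {w : BigMVars n ℓ N | w.1 ∈ X ∧ Q w.1 (ξ i) ≤ w.2.1 i} := fun i =>
    (hQ i).2.preimage ((ContinuousLinearMap.fst ℝ _ _).prod
      ((ContinuousLinearMap.proj (φ := fun _ => ℝ) i).comp ((ContinuousLinearMap.fst ℝ _ _).comp
        (ContinuousLinearMap.snd ℝ _ _))) : BigMVars n ℓ N →L[ℝ] (Fin n → ℝ) × ℝ)
  have hXw : IsMICPR {w : BigMVars n ℓ N | w.1 ∈ X} :=
    hX.preimage (ContinuousLinearMap.fst ℝ _ _ : BigMVars n ℓ N →L[ℝ] Fin n → ℝ)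
  have key := ((hβ.sub (.sum fun j => (hα j).mul_const (d j : ℝ))).isMICPR_le ht).inter <|
    (IsMICPR.setOf_forall fun j => h0.isMICPR_le (hα j)).inter <|
    (IsMICPR.setOf_forall fun j => (hα j).isMICPR_le ((hz j).const_mul (M₁ j))).inter <|
    (IsMICPR.setOf_forall fun j => h0.isMICPR_le (hps j)).inter <|
    (IsMICPR.setOf_forall fun j => (hps j).isMICPR_le ((h1.sub (hz j)).const_mul (M₂ j))).inter <|
    (IsMICPR.setOf_forall fun i => h0.isMICPR_le (hp i)).inter <|
    (IsMICPR.setOf_forall fun i => (hp i).isMICPR_le (hzb i)).inter <|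
    ((IsContAffine.sum hp).isMICPR_eq h1).inter <|
    (IsMICPR.setOf_forall fun i => h0.isMICPR_le (hds i)).inter <|
    (IsMICPR.setOf_forall fun i => (hds i).isMICPR_le ((h1.sub (hzb i)).const_mul (Mb i))).inter <|
    (IsMICPR.setOf_forall hcost).inter <|
    (IsMICPR.setOf_forall fun j => (hz j).isMICPR_binary).inter <|
    (IsMICPR.setOf_forall fun i => (hzb i).isMICPR_binary).inter hXw
  convert! key using 1
  ext ⟨x, v, t, α, β, z, zb, p⟩
  constructor
  · intro h
    exact ⟨h.1, h.2, h.3, h.4, h.5, h.6, h.7, h.8, h.9, h.10, fun i => ⟨h.14, h.11 i⟩, h.12,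
      h.13, h.14⟩
  · rintro ⟨h1, h2, h3, h4, h5, h6, h7, h8, h9, h10, h11, h12, h13, h14⟩
    exact ⟨h1, h2, h3, h4, h5, h6, h7, h8, h9, h10, fun i => (h11 i).2, h12, h13, h14⟩

theorem IsMICPRFun.of_isMICPR_of_isContAffine {E : Type*} [AddCommGroup E] [Module ℝ E]
    [TopologicalSpace E] {S : Set E} {f : E → ℝ} (hS : IsMICPR S) (hf : IsContAffine f) :
    IsMICPRFun S f := by
  refine ⟨hS, (hS.preimage (ContinuousLinearMap.fst ℝ E ℝ)).inter
    (IsContAffine.isMICPR_le (f := fun q : E × ℝ => f q.1) (g := fun q => q.2) ?_ ?_)⟩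
  · exact ⟨hf.1.comp continuous_fst, fun x y a b h => hf.2 _ _ a b h⟩
  · exact ⟨continuous_snd, fun _ _ _ _ _ => rfl⟩

/-! ### Encoding lengths dominate products of row sums. -/

theorem one_add_sum_le_prod_one_add {ι : Type*} (s : Finset ι) (f : ι → ℝ) (hf : ∀ i, 0 ≤ f i) :
    1 + ∑ i ∈ s, f i ≤ ∏ i ∈ s, (1 + f i) := by
  classical
  induction s using Finset.induction_on with
  | empty => simp
  | insert i s hi ih =>
    rw [Finset.sum_insert hi, Finset.prod_insert hi]
    nlinarith [hf i, Finset.sum_nonneg fun k (_ : k ∈ s) => hf k]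

/-- The summand 1 in the encoding length supplies the factor 2, which is spent later on the dual
slack bound. -/
theorem two_mul_one_add_abs_le_two_pow_intEncodingLength (k : ℤ) :
    2 * (1 + |(k : ℝ)|) ≤ 2 ^ intEncodingLength k := by
  have h : k.natAbs + 1 ≤ 2 ^ Nat.clog 2 (k.natAbs + 1) := Nat.le_pow_clog one_lt_two _
  have h' : |(k : ℝ)| + 1 ≤ 2 ^ Nat.clog 2 (k.natAbs + 1) := by
    rw [← Int.cast_abs, Int.abs_eq_natAbs]
    exact_mod_cast h
  rw [intEncodingLength, pow_add, pow_one]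
  linarith

/-- The integral matrix `(-Dᵀ, σ e)`. -/
def columnMatrix {ℓ N : ℕ} (D : Matrix (Fin ℓ) (Fin N) ℤ) (σ : ℤ) :
    Matrix (Fin N) (Fin ℓ ⊕ Unit) ℤ :=
  fun i => Sum.elim (fun j => -D j i) fun _ => σ

theorem two_mul_one_add_sum_abs_le_two_pow_rowEncodingLength {ℓ N : ℕ}
    (D : Matrix (Fin ℓ) (Fin N) ℤ) (d : Fin ℓ → ℚ) {σ : ℤ} (hσ : |σ| = 1) (i : Fin N) :
    2 * (1 + ∑ c, |(columnMatrix D σ i c : ℝ)|) ≤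
      2 ^ rowEncodingLength (dualMatrix D d) (.inr i) := by
  have henc : ∀ c, 2 * (1 + |(columnMatrix D σ i c : ℝ)|) ≤
      2 ^ ratEncodingLength (dualMatrix D d (.inr i) c) := by
    rintro (j | _)
    · have h : ratEncodingLength (dualMatrix D d (.inr i) (.inl j)) = intEncodingLength (D j i) := by
        simp [dualMatrix, ratEncodingLength]
      rw [h]
      simpa [columnMatrix] using two_mul_one_add_abs_le_two_pow_intEncodingLength (D j i)
    · have h : ratEncodingLength (dualMatrix D d (.inr i) (.inr ())) = intEncodingLength 1 := by
        simp [dualMatrix, ratEncodingLength]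
      rw [h]
      have hσ' : |(σ : ℝ)| = 1 := by exact_mod_cast hσ
      simpa [columnMatrix, hσ'] using two_mul_one_add_abs_le_two_pow_intEncodingLength 1
  rw [rowEncodingLength, ← Finset.prod_pow_eq_pow_sum]
  calc 2 * (1 + ∑ c, |(columnMatrix D σ i c : ℝ)|)
      ≤ 2 ^ Fintype.card (Fin ℓ ⊕ Unit) * ∏ c, (1 + |(columnMatrix D σ i c : ℝ)|) := by
        refine mul_le_mul ?_ (one_add_sum_le_prod_one_add _ _ fun _ => abs_nonneg _)
          (add_nonneg zero_le_one (Finset.sum_nonneg fun _ _ => abs_nonneg _)) (by positivity)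
        -- Every entry contributes a factor 2; only one is kept for the whole row.
        exact le_self_pow₀ one_le_two Fintype.card_ne_zero
    _ = ∏ c, 2 * (1 + |(columnMatrix D σ i c : ℝ)|) := by
        rw [Finset.prod_mul_distrib, Finset.prod_const, Finset.card_univ]
    _ ≤ _ := Finset.prod_le_prod (fun _ _ => by positivity) fun c _ => henc c

/-- All factors are at least 1, so `T` may be enlarged to exactly `ℓ + 1` rows, which exist because
`ℓ + 1 ≤ N`. The row containing `d` is never selected. -/
theorem two_mul_prod_le_two_pow_maxRowsEncodingLength {ℓ N : ℕ} (hN : ℓ + 1 ≤ N)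
    (D : Matrix (Fin ℓ) (Fin N) ℤ) (d : Fin ℓ → ℚ) {σ : ℤ} (hσ : |σ| = 1) (T : Finset (Fin N))
    (hT : T.card ≤ ℓ + 1) :
    2 * ∏ i ∈ T, (1 + ∑ c, |(columnMatrix D σ i c : ℝ)|) ≤
      2 ^ maxRowsEncodingLength (dualMatrix D d) (ℓ + 1) := by
  obtain ⟨S, hTS, hS⟩ := Finset.exists_superset_card_eq hT (by simpa using hN)
  have h1 : ∀ i, 1 ≤ 1 + ∑ c, |(columnMatrix D σ i c : ℝ)| := fun i =>
    le_add_of_nonneg_right (Finset.sum_nonneg fun _ _ => abs_nonneg _)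
  have hL : ∑ i ∈ S, rowEncodingLength (dualMatrix D d) (.inr i) ≤
      maxRowsEncodingLength (dualMatrix D d) (ℓ + 1) := by
    have h := Finset.le_sup (f := fun S : Finset (Unit ⊕ Fin N) =>
      ∑ r ∈ S, rowEncodingLength (dualMatrix D d) r)
      (show S.map .inr ∈ Finset.powersetCard (ℓ + 1) Finset.univ by
        simp [Finset.mem_powersetCard, hS])
    simpa [maxRowsEncodingLength] using h
  calc 2 * ∏ i ∈ T, (1 + ∑ c, |(columnMatrix D σ i c : ℝ)|)
      ≤ 2 ^ S.card * ∏ i ∈ S, (1 + ∑ c, |(columnMatrix D σ i c : ℝ)|) := by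
        refine mul_le_mul (le_self_pow₀ one_le_two (by omega)) ?_
          (Finset.prod_nonneg fun i _ => zero_le_one.trans (h1 i)) (by positivity)
        rw [← Finset.prod_sdiff hTS]
        refine le_mul_of_one_le_left (Finset.prod_nonneg fun i _ => zero_le_one.trans (h1 i)) ?_
        simpa using Finset.prod_le_prod (s := S \ T) (f := fun _ => (1 : ℝ))
          (fun _ _ => zero_le_one) fun i _ => h1 i
    _ = ∏ i ∈ S, 2 * (1 + ∑ c, |(columnMatrix D σ i c : ℝ)|) := by
        rw [Finset.prod_mul_distrib, Finset.prod_const]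
    _ ≤ ∏ i ∈ S, 2 ^ rowEncodingLength (dualMatrix D d) (.inr i) :=
        Finset.prod_le_prod (fun i _ => by linarith [h1 i]) fun i _ =>
          two_mul_one_add_sum_abs_le_two_pow_rowEncodingLength D d hσ i
    _ = 2 ^ ∑ i ∈ S, rowEncodingLength (dualMatrix D d) (.inr i) :=
        Finset.prod_pow_eq_pow_sum _ _ _
    _ ≤ _ := pow_le_pow_right₀ one_le_two hL

/-! ### Bounded basic solutions. -/

theorem sum_subtype_eq_sum_of_eq_zero {C : Type*} [Fintype C] {p : C → Prop} [DecidablePred p]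
    (F : C → ℝ) (h : ∀ c, ¬ p c → F c = 0) : ∑ c : {c // p c}, F c = ∑ c, F c := by
  rw [← Finset.sum_subtype (Finset.univ.filter p) (by simp) F]
  exact Finset.sum_filter_of_ne fun c _ hc => by_contra fun hp => hc (h c hp)

/-- Basic solutions: a nonnegative solution of `A w + s = b`, `A` integral, can be replaced by
one with smaller supports and with entries bounded in terms of `A` and `b`. -/
theorem exists_basic_solution {R C : Type*} [Fintype R] [Fintype C] (A : Matrix R C ℤ)
    (w : C → ℝ) (s b : R → ℝ) (hw : ∀ c, 0 ≤ w c) (hs : ∀ r, 0 ≤ s r)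
    (hb : ∀ r, ∑ c, (A r c : ℝ) * w c + s r = b r) {u K : ℝ} (hu : ∀ r, |b r| ≤ u) (hu0 : 0 ≤ u)
    (hK : ∀ T : Finset R, T.card ≤ Fintype.card C → ∏ r ∈ T, (1 + ∑ c, |(A r c : ℝ)|) ≤ K) :
    ∃ (w' : C → ℝ) (s' : R → ℝ), (∀ c, 0 ≤ w' c) ∧ (∀ r, 0 ≤ s' r) ∧
      (∀ r, ∑ c, (A r c : ℝ) * w' c + s' r = b r) ∧ (∀ c, w c = 0 → w' c = 0) ∧
      (∀ r, s r = 0 → s' r = 0) ∧ ∀ c, w' c ≤ u * K := by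
  classical
  -- The columns of `(A, I)`: the slacks become coefficients of unit vectors.
  let v : C ⊕ R → R → ℝ := Sum.elim (fun c r => (A r c : ℝ)) fun r => Pi.single r 1
  have hv : ∀ (g : C ⊕ R → ℝ) (r : R), (∑ k, g k • v k) r =
      ∑ c, (A r c : ℝ) * g (.inl c) + g (.inr r) := by
    intro g r
    simp [v, Fintype.sum_sum_type, Finset.sum_apply, Pi.single_apply, mul_comm]
  obtain ⟨g, hg0, hg, hsupp, hli⟩ := exists_nonneg_combination_linearIndepOn v (Sum.elim w s)
    (by rintro (c | r) <;> simp [hw, hs])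
  have hgb : ∀ r, ∑ c, (A r c : ℝ) * g (.inl c) + g (.inr r) = b r := by
    intro r
    rw [← hv g r, hg, hv, ← hb r]
    simp
  refine ⟨fun c => g (.inl c), fun r => g (.inr r), fun c => hg0 _, fun r => hg0 _, hgb,
    fun c hc => hsupp _ hc, fun r hr => hsupp _ hr, fun c => ?_⟩
  have hK1 : 1 ≤ K := by simpa using hK ∅ (by simp)
  by_cases hc : g (.inl c) = 0
  · exact hc.le.trans (by positivity)
  -- Tight rows and active columns. A dependence among these columns extends to one among the active
  -- columns of `(A, I)`, the slack coefficients being chosen to cancel the remaining rows.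
  let B : Matrix {r // g (.inr r) = 0} {c // g (.inl c) ≠ 0} ℤ := A.submatrix (↑) (↑)
  have hBli : LinearIndependent ℝ (B.map (Int.cast : ℤ → ℝ)).col := by
    rw [Fintype.linearIndependent_iff]
    intro y hy c₀
    let y' : C → ℝ := fun c => if h : g (.inl c) ≠ 0 then y ⟨c, h⟩ else 0
    have hsum : ∀ r, ∑ c, (A r c : ℝ) * y' c =
        ∑ c : {c // g (.inl c) ≠ 0}, (A r c : ℝ) * y c := by
      intro r
      rw [← sum_subtype_eq_sum_of_eq_zero (p := fun c => g (.inl c) ≠ 0)]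
      · exact Finset.sum_congr rfl fun c _ => by simp [y', c.2]
      · intro c hc
        simp [y', hc]
    let G : C ⊕ R → ℝ := Sum.elim y' fun r => -∑ c, (A r c : ℝ) * y' c
    have hG0 : ∀ k, g k = 0 → G k = 0 := by
      rintro (c | r) hk
      · simp [G, y', hk]
      · have h := congrFun hy ⟨r, hk⟩
        simp only [G, Sum.elim_inr, neg_eq_zero, hsum]
        simpa [B, Finset.sum_apply, mul_comm, Matrix.col] using h
    have hGv : ∑ k, G k • v k = 0 := by
      ext r
      rw [hv]
      simp [G]
    have hset : {k | g k ≠ 0} = ((Finset.univ.filter fun k => g k ≠ 0 : Finset _) : Set (C ⊕ R)) := by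
      ext
      simp
    rw [hset, linearIndepOn_finset_iff] at hli
    have h := hli G (by
      rw [← hGv, Finset.sum_filter]
      refine Finset.sum_congr rfl fun k _ => ?_
      by_cases hk : g k = 0 <;> simp [hk, hG0]) (.inl c₀) (by simpa using c₀.2)
    simpa [G, y', c₀.2] using h
  obtain ⟨f, hf, hle⟩ := exists_abs_le_of_linearIndependent_col B hBli
    (fun c => g (.inl c)) (u := u) (by
      intro r
      have h := hgb r
      rw [r.2, add_zero] at h
      have h2 : ∑ c : {c // g (.inl c) ≠ 0}, (B r c : ℝ) * g (.inl c) =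
          ∑ c, (A r c : ℝ) * g (.inl c) := by
        exact sum_subtype_eq_sum_of_eq_zero (p := fun c => g (.inl c) ≠ 0)
          (fun c => (A r c : ℝ) * g (.inl c)) fun c hc => by simp [not_not.1 hc]
      rw [h2, h]
      exact hu r)
  refine (le_abs_self _).trans ((hle ⟨c, hc⟩).trans (mul_le_mul_of_nonneg_left ?_ hu0))
  refine le_trans ?_ (hK (Finset.univ.image fun k => (f k : R)) ?_)
  · rw [Finset.prod_image fun k _ k' _ h => hf (Subtype.ext h)]
    refine Finset.prod_le_prod (fun k _ => by positivity) fun k _ => ?_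
    gcongr
    have h := Finset.sum_le_univ_sum_of_nonneg (s := Finset.univ.filter fun c => g (.inl c) ≠ 0)
      (f := fun c => |(A (f k) c : ℝ)|) fun _ => abs_nonneg _
    rwa [Finset.sum_subtype (Finset.univ.filter fun c => g (.inl c) ≠ 0)
      (p := fun c => g (.inl c) ≠ 0) (by simp)] at h
  · exact Finset.card_image_le.trans (Fintype.card_subtype_le _)

/-! ### Linear programming duality. -/

/-- Strong duality and complementary slackness for the linear program
`min {cᵀp : p ≥ 0, D p ≤ d, eᵀp = 1}`. -/
theorem exists_complementary_solutions {ι κ : Type*} [Fintype ι] [Fintype κ]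
    (D : κ → ι → ℝ) (d : κ → ℝ) (c : ι → ℝ) {P : Set (ι → ℝ)}
    (hP : P = {p | (∀ i, 0 ≤ p i) ∧ (∀ j, ∑ i, D j i * p i ≤ d j) ∧ ∑ i, p i = 1})
    (hne : P.Nonempty) :
    ∃ p ∈ P, (∀ q ∈ P, ∑ i, p i * c i ≤ ∑ i, q i * c i) ∧
      ∃ (α : κ → ℝ) (s : ι → ℝ) (β : ℝ), (∀ j, 0 ≤ α j) ∧ (∀ i, 0 ≤ s i) ∧
        (∀ i, c i = β - ∑ j, D j i * α j + s i) ∧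
        (∀ j, α j * (d j - ∑ i, D j i * p i) = 0) ∧ ∀ i, s i * p i = 0 := by
  classical
  have hclosed : IsClosed P := by
    rw [hP]
    simp only [Set.ofPred_and, Set.ofPred_forall]
    refine (isClosed_iInter fun i => isClosed_le (by fun_prop) (by fun_prop)).inter
      ((isClosed_iInter fun j => isClosed_le (by fun_prop) (by fun_prop)).inter
        (isClosed_eq (by fun_prop) (by fun_prop)))
  have hcompact : IsCompact P := by
    refine (isCompact_Icc (a := (0 : ι → ℝ)) (b := 1)).of_isClosed_subset hclosed fun p hp => ?_
    rw [hP] at hp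
    refine ⟨fun i => hp.1 i, fun i => ?_⟩
    rw [Pi.one_apply, ← hp.2.2]
    exact Finset.single_le_sum (fun k _ => hp.1 k) (Finset.mem_univ i)
  obtain ⟨p, hpP, hmin⟩ := hcompact.exists_isMinOn hne
    (f := fun p => ∑ i, p i * c i) (by fun_prop)
  refine ⟨p, hpP, fun q hq => hmin hq, ?_⟩
  set γ := ∑ i, p i * c i with hγ
  -- Nonnegative combinations equal to `(c, γ)` encode `c = β e - Dᵀ α + s` and `γ = β - αᵀ d - r`.
  -- The `Bool` pair represents the free variable `β`, the `Unit` generator the surplus `r`.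
  let v : κ ⊕ ι ⊕ Bool ⊕ Unit → (ι → ℝ) × ℝ :=
    Sum.elim (fun j => (fun i => -D j i, -d j)) <| Sum.elim (fun i => (Pi.single i 1, 0)) <|
      Sum.elim (fun b => if b then (1, 1) else (-1, -1)) fun _ => (0, -1)
  obtain ⟨w, hw, hwv⟩ := exists_nonneg_combination_of_forall_dual v (c, γ) (by
    intro f hf
    let h : ι → ℝ := fun i => f (Pi.single i 1, 0)
    obtain ⟨τ, hτ⟩ : ∃ τ, τ = f (0, 1) := ⟨_, rfl⟩
    have hfe : ∀ (x : ι → ℝ) (r : ℝ), f (x, r) = ∑ i, x i * h i + r * τ := by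
      intro x r
      have : (x, r) = ∑ i, x i • ((Pi.single i 1, 0) : (ι → ℝ) × ℝ) + r • (0, 1) := by
        ext i
        · simp [Prod.fst_sum, Finset.sum_apply, Pi.single_apply]
        · simp [Prod.snd_sum]
      rw [this, map_add, map_sum, map_smul, smul_eq_mul, hτ]
      simp only [map_smul, smul_eq_mul, h]
    have hh : ∀ i, 0 ≤ h i := fun i => hf (.inr (.inl i))
    have hD : ∀ j, 0 ≤ ∑ i, -D j i * h i + -d j * τ := fun j =>
      (hf (.inl j)).trans_eq (hfe _ _)
    have h1 := (hf (.inr (.inr (.inl true)))).trans_eq (hfe 1 1)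
    have h2 := (hf (.inr (.inr (.inl false)))).trans_eq (hfe (-1) (-1))
    have h3 := (hf (.inr (.inr (.inr ())))).trans_eq (hfe 0 (-1))
    rw [hfe]
    simp only [Pi.one_apply, Pi.neg_apply, Pi.zero_apply, one_mul, zero_mul, neg_mul,
      Finset.sum_neg_distrib, Finset.sum_const_zero] at hD h1 h2 h3
    have hsum : ∑ i, h i = -τ := by linarith
    -- The functional is a pair `(h, τ)` with `h ≥ 0` and `∑ h = -τ`. Either it vanishes, or `h /
    -- (-τ)` lies in `P` and optimality of `p` gives the inequality.
    rcases (show 0 ≤ -τ by linarith).eq_or_lt with h0 | hpos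
    · have hz : ∀ i, h i = 0 := fun i =>
        (Finset.sum_eq_zero_iff_of_nonneg fun i _ => hh i).1 (hsum.trans h0.symm) i
          (Finset.mem_univ i)
      have : τ = 0 := by linarith
      simp [hz, this]
    · have hq : (fun i => (-τ)⁻¹ * h i) ∈ P := by
        rw [hP]
        refine ⟨fun i => mul_nonneg (inv_nonneg.2 hpos.le) (hh i), fun j => ?_, ?_⟩
        · simp only [mul_left_comm _ (-τ)⁻¹, ← Finset.mul_sum]
          rw [inv_mul_le_iff₀ hpos]
          linarith [hD j]
        · rw [← Finset.mul_sum, hsum, inv_mul_cancel₀ hpos.ne']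
      have hle : γ ≤ ∑ i, (-τ)⁻¹ * h i * c i := hmin hq
      simp only [mul_assoc, ← Finset.mul_sum] at hle
      rw [le_inv_mul_iff₀ hpos] at hle
      simp only [mul_comm (c _)]
      linarith)
  set β := w (.inr (.inr (.inl true))) - w (.inr (.inr (.inl false))) with hβ
  set r := w (.inr (.inr (.inr ()))) with hr
  have hc : ∀ i, c i = β - ∑ j, D j i * w (.inl j) + w (.inr (.inl i)) := by
    intro i
    have h := congrFun (congrArg Prod.fst hwv) i
    simp [v, Prod.fst_sum, Fintype.sum_sum_type, Finset.sum_apply, Pi.single_apply] at h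
    simp only [mul_comm (D _ _), hβ]
    linarith
  have hγ' : γ = β - ∑ j, w (.inl j) * d j - r := by
    have h := congrArg Prod.snd hwv
    simp [v, Prod.snd_sum, Fintype.sum_sum_type] at h
    rw [hβ, hr]
    linarith
  rw [hP] at hpP
  obtain ⟨hp0, hpD, hp1⟩ := hpP
  have hexp : γ = β - ∑ j, w (.inl j) * ∑ i, D j i * p i + ∑ i, w (.inr (.inl i)) * p i := by
    rw [hγ]
    simp only [hc, mul_add, mul_sub, Finset.sum_add_distrib, Finset.sum_sub_distrib,
      ← Finset.sum_mul, hp1, one_mul, Finset.mul_sum]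
    rw [Finset.sum_comm]
    congr 1
    · congr 1
      exact Finset.sum_congr rfl fun j _ => Finset.sum_congr rfl fun i _ => by ring
    · exact Finset.sum_congr rfl fun i _ => mul_comm _ _
  have hA : ∀ j, 0 ≤ w (.inl j) * (d j - ∑ i, D j i * p i) := fun j =>
    mul_nonneg (hw _) (sub_nonneg.2 (hpD j))
  have hS : ∀ i, 0 ≤ w (.inr (.inl i)) * p i := fun i => mul_nonneg (hw _) (hp0 i)
  have hr0 : 0 ≤ r := hw _
  -- Comparing the two expressions for `γ` gives nonnegative terms with sum zero, so each vanishes: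
  -- complementary slackness.
  have htot : ∑ j, w (.inl j) * (d j - ∑ i, D j i * p i) + ∑ i, w (.inr (.inl i)) * p i + r = 0 := by
    simp only [mul_sub, Finset.sum_sub_distrib]
    linarith
  have hA0 := Finset.sum_nonneg fun j (_ : j ∈ Finset.univ) => hA j
  have hS0 := Finset.sum_nonneg fun i (_ : i ∈ Finset.univ) => hS i
  refine ⟨fun j => w (.inl j), fun i => w (.inr (.inl i)), β, fun j => hw _, fun i => hw _, hc,
    fun j => ?_, fun i => ?_⟩
  · exact (Finset.sum_eq_zero_iff_of_nonneg fun j _ => hA j).1 (by linarith) j (Finset.mem_univ j)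
  · exact (Finset.sum_eq_zero_iff_of_nonneg fun i _ => hS i).1 (by linarith) i (Finset.mem_univ i)

/-- A dual solution complementary to an optimal `p` whose entries are bounded by the encoding
length of the data. -/
theorem exists_bounded_complementary_solutions {ℓ N : ℕ} (hN : ℓ + 1 ≤ N)
    (D : Matrix (Fin ℓ) (Fin N) ℤ) (d : Fin ℓ → ℚ) (c : Fin N → ℝ) {u : ℝ}
    (hu : ∀ i, |c i| ≤ u) (hne : (ambiguitySet D d).Nonempty) :
    ∃ p ∈ ambiguitySet D d, (∀ q ∈ ambiguitySet D d, ∑ i, p i * c i ≤ ∑ i, q i * c i) ∧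
      ∃ (α : Fin ℓ → ℝ) (s : Fin N → ℝ) (β : ℝ), (∀ j, 0 ≤ α j) ∧ (∀ i, 0 ≤ s i) ∧
        (∀ i, c i = β - ∑ j, (D j i : ℝ) * α j + s i) ∧
        (∀ j, α j ≠ 0 → (d j : ℝ) - ∑ i, (D j i : ℝ) * p i = 0) ∧ (∀ i, p i ≠ 0 → s i = 0) ∧
        (∀ j, 2 * α j ≤ u * 2 ^ maxRowsEncodingLength (dualMatrix D d) (ℓ + 1)) ∧
        2 * |β| ≤ u * 2 ^ maxRowsEncodingLength (dualMatrix D d) (ℓ + 1) := by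
  obtain ⟨p, hp, hmin, α, s, β, hα, hs, hc, hαc, hsc⟩ := exists_complementary_solutions
    (fun j i => (D j i : ℝ)) (fun j => (d j : ℝ)) c (P := ambiguitySet D d) rfl hne
  refine ⟨p, hp, hmin, ?_⟩
  -- The free variable `β` becomes the nonnegative variable `|β|`, its sign moving into the last
  -- column of the matrix.
  obtain ⟨σ, hσ, hσβ⟩ : ∃ σ : ℤ, |σ| = 1 ∧ (σ : ℝ) * |β| = β := by
    rcases le_total 0 β with h | h
    · exact ⟨1, by simp, by simp [abs_of_nonneg h]⟩
    · exact ⟨-1, by simp, by simp [abs_of_nonpos h]⟩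
  have hσ' : |(σ : ℝ)| = 1 := by exact_mod_cast hσ
  have hu0 : 0 ≤ u := (abs_nonneg _).trans (hu ⟨0, by omega⟩)
  obtain ⟨w, s', hw, hs', hws, hw0, hs0, hwle⟩ := exists_basic_solution (columnMatrix D σ)
    (Sum.elim α fun _ => |β|) s c (by rintro (j | _) <;> simp [hα]) hs
    (fun i => by
      rw [hc i, Fintype.sum_sum_type]
      simp [columnMatrix, hσβ]
      ring) hu hu0 (K := 2 ^ maxRowsEncodingLength (dualMatrix D d) (ℓ + 1) / 2)
    (fun T hT => by
      have := two_mul_prod_le_two_pow_maxRowsEncodingLength hN D d hσ T (by simpa using hT)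
      linarith)
  refine ⟨fun j => w (.inl j), s', σ * w (.inr ()), fun j => hw _, hs', fun i => ?_, fun j hj => ?_,
    fun i hi => ?_, fun j => ?_, ?_⟩
  · rw [← hws i, Fintype.sum_sum_type]
    simp [columnMatrix]
    ring
  · exact (mul_eq_zero.1 (hαc j)).resolve_left fun h => hj (hw0 _ h)
  · exact hs0 i ((mul_eq_zero.1 (hsc i)).resolve_right hi)
  · linarith [hwle (.inl j)]
  · rw [abs_mul, hσ', one_mul, abs_of_nonneg (hw _)]
    linarith [hwle (.inr ())]

/-! ### Equivalence of the two problems. -/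

/-- For either value of a binary, one factor of the corresponding complementarity product is
squeezed to zero. Weak duality thus holds with equality: `pᵀ v = β - αᵀ d`. -/
theorem BigMFeasible.mem_ambiguitySet_and_le {n m ℓ N : ℕ} {X : Set (Fin n → ℝ)}
    {Q : (Fin n → ℝ) → (Fin m → ℝ) → ℝ} {ξ : Fin N → Fin m → ℝ}
    {D : Matrix (Fin ℓ) (Fin N) ℤ} {d : Fin ℓ → ℚ} {M₁ M₂ : Fin ℓ → ℝ} {Mb : Fin N → ℝ}
    {x : Fin n → ℝ} {v : Fin N → ℝ} {t : ℝ} {α : Fin ℓ → ℝ} {β : ℝ} {z : Fin ℓ → ℝ}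
    {zb p : Fin N → ℝ} (h : BigMFeasible X Q ξ D d M₁ M₂ Mb x v t α β z zb p) :
    p ∈ ambiguitySet D d ∧ ∑ i, p i * Q x (ξ i) ≤ t := by
  refine ⟨⟨h.p_nonneg, fun j => sub_nonneg.1 (h.primal_slack_nonneg j), h.p_sum⟩, ?_⟩
  have hα : ∀ j, α j * ((d j : ℝ) - ∑ i, (D j i : ℝ) * p i) = 0 := by
    intro j
    rcases h.z_binary j with hz | hz
    · have := h.alpha_le j
      rw [hz, mul_zero] at this
      rw [le_antisymm this (h.alpha_nonneg j), zero_mul]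
    · have := h.primal_slack_le j
      rw [hz, sub_self, mul_zero] at this
      rw [le_antisymm this (h.primal_slack_nonneg j), mul_zero]
  have hs : ∀ i, p i * (v i + ∑ j, (D j i : ℝ) * α j - β) = 0 := by
    intro i
    rcases h.zb_binary i with hz | hz
    · have := h.p_le i
      rw [hz] at this
      rw [le_antisymm this (h.p_nonneg i), zero_mul]
    · have := h.dual_slack_le i
      rw [hz, sub_self, mul_zero] at this
      rw [le_antisymm this (h.dual_slack_nonneg i), mul_zero]
  calc ∑ i, p i * Q x (ξ i) ≤ ∑ i, p i * v i :=
        Finset.sum_le_sum fun i _ => mul_le_mul_of_nonneg_left (h.cost_le i) (h.p_nonneg i)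
    _ = ∑ i, (p i * β - p i * ∑ j, (D j i : ℝ) * α j) :=
        Finset.sum_congr rfl fun i _ => by linarith [hs i]
    _ = β - ∑ j, α j * ∑ i, (D j i : ℝ) * p i := by
        rw [Finset.sum_sub_distrib, ← Finset.sum_mul, h.p_sum, one_mul]
        simp only [Finset.mul_sum]
        rw [Finset.sum_comm]
        congr 1
        exact Finset.sum_congr rfl fun j _ => Finset.sum_congr rfl fun i _ => by ring
    _ = β - ∑ j, α j * (d j : ℝ) := by
        congr 1
        exact Finset.sum_congr rfl fun j _ => by linarith [hα j]
    _ ≤ t := h.objective_le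

/-- The witness uses a minimiser `p` for the given `x` instead of `q`, takes `v` equal to the costs,
and lets the binaries indicate the supports of `α` and `p`. -/
theorem exists_bigMFeasible {n m ℓ N : ℕ} (hN : ℓ + 1 ≤ N)
    (X : Set (Fin n → ℝ)) (Q : (Fin n → ℝ) → (Fin m → ℝ) → ℝ) (ξ : Fin N → Fin m → ℝ)
    (D : Matrix (Fin ℓ) (Fin N) ℤ) (d : Fin ℓ → ℚ)
    (U : Fin N → ℝ) (hU : ∀ i, IsLUB ((fun x => |Q x (ξ i)|) '' X) (U i))
    (L : ℕ) (hL : L = maxRowsEncodingLength (dualMatrix D d) (ℓ + 1))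
    (M₁ M₂ : Fin ℓ → ℝ) (Mb : Fin N → ℝ)
    (hM₁ : ∀ j, (⨆ i, U i) * (ℓ + 1) * 2 ^ L ≤ M₁ j)
    (hM₂ : ∀ j, (d j : ℝ) + ∑ i, |(D j i : ℝ)| ≤ M₂ j)
    (hMb : ∀ i, (⨆ k, U k) * (∑ j, |(D j i : ℝ)| + 1) * (ℓ + 1) * 2 ^ L
      + (⨅ k, U k) * (ℓ + 1) * 2 ^ L ≤ Mb i)
    {x : Fin n → ℝ} (hx : x ∈ X) {q : Fin N → ℝ} (hq : q ∈ ambiguitySet D d) {t : ℝ}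
    (hqt : ∑ i, q i * Q x (ξ i) ≤ t) :
    ∃ (v : Fin N → ℝ) (α : Fin ℓ → ℝ) (β : ℝ) (z : Fin ℓ → ℝ) (zb p : Fin N → ℝ),
      BigMFeasible X Q ξ D d M₁ M₂ Mb x v t α β z zb p := by
  classical
  have hQU : ∀ i, |Q x (ξ i)| ≤ U i := fun i => (hU i).1 ⟨x, hx, rfl⟩
  have hQu : ∀ i, |Q x (ξ i)| ≤ ⨆ i, U i := fun i =>
    (hQU i).trans (le_ciSup (Set.finite_range U).bddAbove i)
  have hinf : 0 ≤ ⨅ k, U k := Real.iInf_nonneg fun k => (abs_nonneg _).trans (hQU k)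
  set u := ⨆ i, U i with hu
  have hu0 : 0 ≤ u := Real.iSup_nonneg fun k => (abs_nonneg _).trans (hQU k)
  obtain ⟨p, hp, hmin, α, s, β, hα, hs, hc, hαc, hsc, hαle, hβle⟩ :=
    exists_bounded_complementary_solutions hN D d (fun i => Q x (ξ i)) hQu ⟨q, hq⟩
  rw [← hL] at hαle hβle
  have hL2 : (2 : ℝ) ≤ 2 ^ L := by
    have := two_mul_prod_le_two_pow_maxRowsEncodingLength hN D d (σ := 1) (by simp) ∅ (by simp)
    rw [← hL] at this
    simpa using this
  have huL : 0 ≤ u * 2 ^ L := by positivity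
  have hℓ : (0 : ℝ) ≤ ℓ := Nat.cast_nonneg ℓ
  have hp1 : ∀ i, p i ≤ 1 := fun i => by
    rw [← hp.2.2]
    exact Finset.single_le_sum (fun k _ => hp.1 k) (Finset.mem_univ i)
  have hslack : ∀ i, Q x (ξ i) + ∑ j, (D j i : ℝ) * α j - β = s i := fun i => by
    linarith [hc i]
  have hsle : ∀ i, s i ≤ Mb i := by
    intro i
    refine le_trans ?_ (hMb i)
    have h1 : ∑ j, (D j i : ℝ) * α j ≤ ∑ j, |(D j i : ℝ)| * (u * 2 ^ L) := by
      refine Finset.sum_le_sum fun j _ => ?_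
      exact mul_le_mul (le_abs_self _) (by linarith [hαle j]) (hα j) (abs_nonneg _)
    rw [← Finset.sum_mul] at h1
    set A := ∑ j, |(D j i : ℝ)|
    have hA : 0 ≤ A := Finset.sum_nonneg fun _ _ => abs_nonneg _
    have h2 : 2 * u ≤ u * 2 ^ L := by nlinarith
    -- The cost and `|β|` are each at most `u * 2 ^ L / 2`, so together they fill the summand 1. The
    -- factor `ℓ + 1` and the term with the infimum are spare room.
    have h3 : s i ≤ (A + 1) * (u * 2 ^ L) := by
      linarith [hslack i, le_abs_self (Q x (ξ i)), hQu i, neg_abs_le β]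
    have h4 : 0 ≤ (A + 1) * (u * 2 ^ L) * ℓ := by positivity
    have h5 : 0 ≤ (⨅ k, U k) * (ℓ + 1) * 2 ^ L := by positivity
    linarith
  refine ⟨fun i => Q x (ξ i), α, β, fun j => if α j = 0 then 0 else 1,
    fun i => if p i = 0 then 0 else 1, p, ?_⟩
  constructor
  · refine le_trans (le_of_eq ?_) ((hmin q hq).trans hqt)
    have h1 : ∀ j, α j * (d j : ℝ) = α j * ∑ i, (D j i : ℝ) * p i := fun j => by
      by_cases h : α j = 0
      · simp [h]
      · rw [sub_eq_zero.1 (hαc j h)]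
    have h2 : ∀ i, p i * s i = 0 := fun i => by
      by_cases h : p i = 0
      · simp [h]
      · simp [hsc i h]
    simp only [h1, hc, mul_add, mul_sub, h2, Finset.sum_sub_distrib, add_zero, ← Finset.sum_mul,
      hp.2.2, one_mul, Finset.mul_sum]
    rw [Finset.sum_comm]
    congr 1
    exact Finset.sum_congr rfl fun j _ => Finset.sum_congr rfl fun i _ => by ring
  · exact hα
  · intro j
    by_cases h : α j = 0
    · simp [h]
    · simp only [h, if_false, mul_one]
      refine le_trans ?_ (hM₁ j)
      have := hαle j
      have h4 : 0 ≤ u * 2 ^ L * ℓ := by positivity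
      linarith
  · exact fun j => sub_nonneg.2 (hp.2.1 j)
  · intro j
    by_cases h : α j = 0
    · simp only [h, if_true, sub_zero, mul_one]
      refine le_trans ?_ (hM₂ j)
      rw [sub_eq_add_neg, ← Finset.sum_neg_distrib]
      gcongr with i
      calc -((D j i : ℝ) * p i) ≤ |(D j i : ℝ) * p i| := neg_le_abs _
        _ = |(D j i : ℝ)| * p i := by rw [abs_mul, abs_of_nonneg (hp.1 i)]
        _ ≤ |(D j i : ℝ)| := mul_le_of_le_one_right (abs_nonneg _) (hp1 i)
    · simp [h, hαc j h]
  · exact hp.1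
  · intro i
    by_cases h : p i = 0
    · simp [h]
    · simpa [h] using hp1 i
  · exact hp.2.2
  · intro i
    rw [hslack]
    exact hs i
  · intro i
    rw [hslack]
    by_cases h : p i = 0
    · simpa [h] using hsle i
    · simp [h, hsc i h]
  · exact fun i => le_rfl
  · intro j
    by_cases h : α j = 0 <;> simp [h]
  · intro i
    by_cases h : p i = 0 <;> simp [h]
  · exact hx

theorem mainTheorem4 {n m ℓ N : ℕ} (hN : ℓ + 1 ≤ N)
    (X : Set (Fin n → ℝ)) (Q : (Fin n → ℝ) → (Fin m → ℝ) → ℝ) (ξ : Fin N → Fin m → ℝ)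
    (D : Matrix (Fin ℓ) (Fin N) ℤ) (d : Fin ℓ → ℚ)
    (hX : IsMICPR X) (hQ : ∀ i, IsMICPRFun X (fun x => Q x (ξ i)))
    (U : Fin N → ℝ) (hU : ∀ i, IsLUB ((fun x => |Q x (ξ i)|) '' X) (U i))
    (L : ℕ) (hL : L = maxRowsEncodingLength (dualMatrix D d) (ℓ + 1))
    (M₁ M₂ : Fin ℓ → ℝ) (Mb : Fin N → ℝ)
    (hM₁ : ∀ j, (⨆ i, U i) * (ℓ + 1) * 2 ^ L ≤ M₁ j)
    (hM₂ : ∀ j, (d j : ℝ) + ∑ i, |(D j i : ℝ)| ≤ M₂ j)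
    (hMb : ∀ i, (⨆ k, U k) * (∑ j, |(D j i : ℝ)| + 1) * (ℓ + 1) * 2 ^ L
      + (⨅ k, U k) * (ℓ + 1) * 2 ^ L ≤ Mb i) :
    IsMICPRFun (bigMRegion X Q ξ D d M₁ M₂ Mb) bigMObjective ∧
    (⨅ r ∈ dfoValues X Q ξ D d, (r : EReal)) =
      (⨅ w ∈ bigMRegion X Q ξ D d M₁ M₂ Mb, (bigMObjective w : EReal)) ∧
    (∀ r : ℝ, IsLeast (dfoValues X Q ξ D d) r ↔
      IsLeast (bigMObjective '' bigMRegion X Q ξ D d M₁ M₂ Mb) r) ∧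
    (∀ (x : Fin n → ℝ) (t : ℝ),
      (x ∈ X ∧ ∃ p ∈ ambiguitySet D d, ∑ i, p i * Q x (ξ i) ≤ t) ↔
      ∃ (v : Fin N → ℝ) (α : Fin ℓ → ℝ) (β : ℝ) (z : Fin ℓ → ℝ) (zb p : Fin N → ℝ),
        BigMFeasible X Q ξ D d M₁ M₂ Mb x v t α β z zb p) := by

  have key : ∀ (x : Fin n → ℝ) (t : ℝ),
      (x ∈ X ∧ ∃ p ∈ ambiguitySet D d, ∑ i, p i * Q x (ξ i) ≤ t) ↔
      ∃ (v : Fin N → ℝ) (α : Fin ℓ → ℝ) (β : ℝ) (z : Fin ℓ → ℝ) (zb p : Fin N → ℝ),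
        BigMFeasible X Q ξ D d M₁ M₂ Mb x v t α β z zb p := by
    refine fun x t => ⟨?_, ?_⟩
    · rintro ⟨hx, q, hq, hqt⟩
      exact exists_bigMFeasible hN X Q ξ D d U hU L hL M₁ M₂ Mb hM₁ hM₂ hMb hx hq hqt
    · rintro ⟨v, α, β, z, zb, p, h⟩
      exact ⟨h.x_mem, p, h.mem_ambiguitySet_and_le⟩
  -- Since `t` need only dominate the dual value, every value of (1) is itself an objective value of
  -- (2). Conversely each objective value of (2) dominates a value of (1); together these match
  -- infima and attained minima.
  have hup : ∀ r ∈ dfoValues X Q ξ D d, ∃ w ∈ bigMRegion X Q ξ D d M₁ M₂ Mb,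
      bigMObjective w = r := by
    rintro r ⟨x, hx, p, hp, rfl⟩
    obtain ⟨v, α, β, z, zb, p, h⟩ := (key x _).1 ⟨hx, p, hp, le_rfl⟩
    exact ⟨(x, v, _, α, β, z, zb, p), h, rfl⟩
  have hdown : ∀ w ∈ bigMRegion X Q ξ D d M₁ M₂ Mb, ∃ r ∈ dfoValues X Q ξ D d,
      r ≤ bigMObjective w := by
    rintro ⟨x, v, t, α, β, z, zb, p⟩ h
    obtain ⟨hx, p, hp, hle⟩ := (key x t).2 ⟨v, α, β, z, zb, p, h⟩
    exact ⟨_, ⟨x, hx, p, hp, rfl⟩, hle⟩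
  refine ⟨.of_isMICPR_of_isContAffine (isMICPR_bigMRegion D d hX hQ M₁ M₂ Mb)
    ⟨by unfold bigMObjective; fun_prop, fun _ _ _ _ _ => rfl⟩, le_antisymm ?_ ?_, fun r => ⟨?_, ?_⟩,
    key⟩
  · refine le_iInf₂ fun w hw => ?_
    obtain ⟨r, hr, hle⟩ := hdown w hw
    exact (iInf₂_le r hr).trans (by exact_mod_cast hle)
  · refine le_iInf₂ fun r hr => ?_
    obtain ⟨w, hw, rfl⟩ := hup r hr
    exact iInf₂_le w hw
  · rintro ⟨hr, hlb⟩
    refine ⟨hup r hr, ?_⟩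
    rintro _ ⟨w, hw, rfl⟩
    obtain ⟨r', hr', hle⟩ := hdown w hw
    exact (hlb hr').trans hle
  · rintro ⟨⟨w, hw, rfl⟩, hlb⟩
    have hlb' : bigMObjective w ∈ lowerBounds (dfoValues X Q ξ D d) := fun r' hr' =>
      hlb (hup r' hr')
    obtain ⟨r, hr, hle⟩ := hdown w hw
    rw [(hlb' hr).antisymm hle]
    exact ⟨hr, fun r' hr' => (hle.trans (hlb' hr'))⟩
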